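/- Let $k\ge 1$, $r\ge 1$, $\delta\ge 2$, $t\ge 0$ and $n$ be integers with $n\ge k\,(t(r+\delta-2)+1)$. Then there are a finite field $\mathbb F$ and a linear subspace $C\subseteq\mathbb F^n$ of dimension $k$ which is a perfect linear $(n,k,d,r,\delta,t)$-LRC with information-symbol locality, that is, whose minimum Hamming distance $d$ satisfies $$d=n-k+1-\left(\left\lceil\frac{t(k-1)+1}{t(r-1)+1}\right\rceil-1\right)(\delta-1),$$ and which has an information set $K\subseteq[n]$ all of whose elements have $(r,\delta,t)$-availability. Here, for $X\subseteq[n]$, $C_X$ denotes the projection of $C$ to the coordinates in $X$; the minimum distance is $d=\min\{|X| : X\subseteq [n],\ |C_{[n]\setminus X}|<|C|\}$. A set $K\subseteq[n]$ is an information set if $|C_K|=|C|$ and $|C_{K\setminus\{i\}}|<|C|$ for every $i\in K$. A coordinate $i$ has $(r,\delta,t)$-availability if there are $t$ sets $R_1,\dots,R_t\subseteq[n]$ with $R_j\cap R_l=\{i\}$ for $j\ne l$, such that each $R=R_j$ satisfies $i\in R$, $|R|\le r+\delta-1$, and $|C_X|=|C_R|$ for every $X\subseteq R\setminus\{i\}$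 with $|X|\ge|R|-(\delta-1)$. -/

import Mathlib

namespace LRC

variable {ι A : Type*}

/-- The projection `C_X` of a code `C ⊆ A^ι` onto the coordinates in `X`. -/
def proj (C : Set (ι → A)) (X : Finset ι) : Set (X → A) :=
  (fun c => X.restrict c) '' C

/-- `d` is the minimum distance of `C`: the least size of a set `X` of coordinates such that
the projection of `C` onto the complement of `X` has fewer elements than `C`. -/
def IsMinDist [Fintype ι] [DecidableEq ι] (C : Set (ι → A)) (d : ℕ) : Prop :=
  IsLeast {m : ℕ | ∃ X : Finset ι, X.card = m ∧ (proj C Xᶜ).ncard < C.ncard} d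

/-- `R` is a local repair set with repair locality `(r, δ)` for the coordinate `i`:
`i ∈ R`, `|R| ≤ r + δ - 1`, and every `X ⊆ R \ {i}` with `|X| ≥ |R| - (δ - 1)` (an inequality
of integers, so that no small `R` qualifies vacuously) satisfies `|C_X| = |C_R|`. -/
structure IsLocalRepairSet [DecidableEq ι] (C : Set (ι → A)) (r δ : ℕ) (i : ι)
    (R : Finset ι) : Prop where
  mem : i ∈ R
  card_le : (R.card : ℤ) ≤ (r : ℤ) + δ - 1
  repair : ∀ X ⊆ R.erase i, (R.card : ℤ) - ((δ : ℤ) - 1) ≤ X.card →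
    (proj C X).ncard = (proj C R).ncard

/-- The coordinate `i` has `(r, δ, t)`-availability: there are `t` local repair sets for `i`
which pairwise meet exactly in `i`. -/
def HasAvailability [DecidableEq ι] (C : Set (ι → A)) (r δ t : ℕ) (i : ι) : Prop :=
  ∃ R : Fin t → Finset ι, (∀ j, IsLocalRepairSet C r δ i (R j)) ∧
    ∀ j l, j ≠ l → R j ∩ R l = {i}

/-- `K` is an information set of `C`. -/
def IsInformationSet [DecidableEq ι] (C : Set (ι → A)) (K : Finset ι) : Prop :=
  (proj C K).ncard = C.ncard ∧ ∀ i ∈ K, (proj C (K.erase i)).ncard < C.ncard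

/-- The subspace `C` of `F^n` is a linear `(n, k, d, r, δ, t)`-LRC with information-symbol
locality. -/
structure IsLinearLRC {F : Type*} [Field F] {n : ℕ} (C : Submodule F (Fin n → F))
    (k d r δ t : ℕ) : Prop where
  finrank_eq : Module.finrank F C = k
  minDist : IsMinDist (C : Set (Fin n → F)) d
  locality : ∃ K : Finset (Fin n), IsInformationSet (C : Set (Fin n → F)) K ∧
    ∀ i ∈ K, HasAvailability (C : Set (Fin n → F)) r δ t i

/-- The Singleton-type bound
`n - k + 1 - (⌈(t(k-1)+1) / (t(r-1)+1)⌉ - 1)(δ - 1)` for integral `k`. -/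
def singletonBound (n k r δ t : ℕ) : ℤ :=
  (n : ℤ) - k + 1 -
    (⌈((t : ℚ) * ((k : ℚ) - 1) + 1) / ((t : ℚ) * ((r : ℚ) - 1) + 1)⌉ - 1) * ((δ : ℤ) - 1)

end LRC

/-! Write `u = r - 1` and `w = δ - 1`. Take `k` centres, each on `t` blocks of `u + w` further
points, and give all remaining coordinates free independent vectors. Over a prime field, a block
with its centre is a Reed–Solomon configuration: `u + w + 1` points of rank `u + 1`, any `u + 1` of
which span it. The points lie in an extension `L`, and codewords evaluate linearized polynomials
with `k` coefficients there. The zeros of such a nonzero polynomial form a subspace of dimension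
below `k`, so zero patterns are governed by linear independence of points (`linearIndepOn_point`,
`eq_zero_of_linearized_eq_zero`).

A codeword gains zeros beyond the rank only in full blocks, at most `w` each. Since `m` full blocks
need `m * u` points and at least `m / t` centres, `m * (t * u + 1) ≤ t * (k - 1)`. The largest such
`m` gives the maximal number `k - 1 + m * w` of zeros (`card_le_of_vanish`,
`exists_card_eq_of_vanish`), and `m` is the ceiling minus one in the bound. -/

namespace LRC

/-! ### Projection sizes in terms of vanishing codewords -/

section Projections

variable {ι F : Type*}

/-- Two nested coordinate sets carry projections of the same size as soon as every codeword
vanishing on the smaller one vanishes on the larger one. -/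
theorem ncard_proj_eq_of_vanish [Field F] (C : Submodule F (ι → F)) {X Y : Finset ι} (hXY : X ⊆ Y)
    (h : ∀ c ∈ C, (∀ x ∈ X, c x = 0) → ∀ y ∈ Y, c y = 0) :
    (proj (C : Set (ι → F)) X).ncard = (proj (C : Set (ι → F)) Y).ncard := by
  have himg : proj (C : Set (ι → F)) X =
      (fun (f : Y → F) (x : X) => f ⟨x, hXY x.2⟩) '' proj (C : Set (ι → F)) Y := by
    simp only [proj, Set.image_image]
    rfl
  rw [himg]
  apply Set.InjOn.ncard_image
  rintro _ ⟨c, hc, rfl⟩ _ ⟨c', hc', rfl⟩ heq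
  funext y
  have := h (c - c') (C.sub_mem hc hc') (fun x hx => by
    have := congrFun heq ⟨x, hx⟩
    simpa [sub_eq_zero] using this) y y.2
  simpa [sub_eq_zero] using this

theorem ncard_proj_univ [Fintype ι] (C : Set (ι → F)) :
    (proj C Finset.univ).ncard = C.ncard := by
  apply Set.ncard_image_of_injective
  intro c c' h
  funext x
  exact congrFun h ⟨x, Finset.mem_univ x⟩

/-- The projection onto `X` is smaller than the code exactly when some nonzero codeword vanishes
on `X`. -/
theorem ncard_proj_lt_iff [Fintype ι] [Field F] [Finite F] (C : Submodule F (ι → F))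
    (X : Finset ι) :
    (proj (C : Set (ι → F)) X).ncard < (C : Set (ι → F)).ncard ↔
      ∃ c ∈ C, c ≠ 0 ∧ ∀ x ∈ X, c x = 0 := by
  constructor
  · intro hlt
    by_contra! hne
    refine hlt.ne ?_
    rw [← ncard_proj_univ (C : Set (ι → F))]
    refine ncard_proj_eq_of_vanish C (Finset.subset_univ X) fun c hc hX y _ => ?_
    by_cases h0 : c = 0
    · simp [h0]
    · obtain ⟨x, hx, hx0⟩ := hne c hc h0
      exact absurd (hX x hx) hx0
  · rintro ⟨c, hc, hc0, hX⟩
    refine lt_of_le_of_ne (Set.ncard_image_le (Set.toFinite _)) fun heq => hc0 ?_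
    refine Set.injOn_of_ncard_image_eq heq (Set.toFinite _) hc C.zero_mem ?_
    funext x
    exact hX x x.2

end Projections

/-! ### Invariance under relabelling coordinates -/

section Transfer

variable {ι κ F : Type*}

theorem ncard_proj_funLeft [Field F] (e : ι ≃ κ) (C : Submodule F (κ → F)) (X : Finset ι) :
    (proj (C.map (LinearMap.funLeft F F e) : Set (ι → F)) X).ncard =
      (proj (C : Set (κ → F)) (X.map e.toEmbedding)).ncard := by
  have himg : proj (C.map (LinearMap.funLeft F F e) : Set (ι → F)) X =
      (fun (f : X.map e.toEmbedding → F) (x : X) =>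
        f ⟨e x, Finset.mem_map_of_mem e.toEmbedding x.2⟩) ''
        proj (C : Set (κ → F)) (X.map e.toEmbedding) := by
    simp only [proj, Set.image_image, Submodule.map_coe]
    rfl
  rw [himg]
  apply Set.ncard_image_of_injective
  intro f f' h
  funext ⟨y, hy⟩
  obtain ⟨x, hx, rfl⟩ := Finset.mem_map.1 hy
  exact congrFun h ⟨x, hx⟩

theorem ncard_map_funLeft [Field F] (e : ι ≃ κ) (C : Submodule F (κ → F)) :
    (C.map (LinearMap.funLeft F F e) : Set (ι → F)).ncard = (C : Set (κ → F)).ncard := by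
  rw [Submodule.map_coe]
  exact Set.ncard_image_of_injective _ (LinearMap.funLeft_injective_of_surjective F F e e.surjective)

variable [DecidableEq ι] [DecidableEq κ]

theorem IsMinDist.map_funLeft [Fintype ι] [Fintype κ] [Field F] (e : ι ≃ κ)
    {C : Submodule F (κ → F)} {d : ℕ} (h : IsMinDist (C : Set (κ → F)) d) :
    IsMinDist (C.map (LinearMap.funLeft F F e) : Set (ι → F)) d := by
  have hcompl (X : Finset ι) : (X.map e.toEmbedding)ᶜ = Xᶜ.map e.toEmbedding := by
    ext y
    obtain ⟨x, rfl⟩ := e.surjective y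
    simp
  constructor
  · obtain ⟨X, hX, hlt⟩ := h.1
    refine ⟨X.map e.symm.toEmbedding, by simpa using hX, ?_⟩
    have hmap : (X.map e.symm.toEmbedding).map e.toEmbedding = X := by
      ext
      simp
    rwa [ncard_proj_funLeft, ncard_map_funLeft, ← hcompl, hmap]
  · rintro _ ⟨X, rfl, hlt⟩
    refine h.2 ⟨X.map e.toEmbedding, by simp, ?_⟩
    rwa [hcompl, ← ncard_proj_funLeft, ← ncard_map_funLeft e]

theorem IsLocalRepairSet.map_funLeft [Field F] (e : ι ≃ κ) {C : Submodule F (κ → F)} {r δ : ℕ}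
    {i : ι} {R : Finset ι}
    (h : IsLocalRepairSet (C : Set (κ → F)) r δ (e i) (R.map e.toEmbedding)) :
    IsLocalRepairSet (C.map (LinearMap.funLeft F F e) : Set (ι → F)) r δ i R where
  mem := by simpa using h.mem
  card_le := by simpa using h.card_le
  repair X hX hcard := by
    rw [ncard_proj_funLeft, ncard_proj_funLeft]
    refine h.repair _ ?_ (by simpa using hcard)
    have := Finset.map_subset_map (f := e.toEmbedding).2 hX
    rwa [Finset.map_erase] at this

theorem HasAvailability.map_funLeft [Field F] (e : ι ≃ κ) {C : Submodule F (κ → F)} {r δ t : ℕ}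
    {i : ι} (h : HasAvailability (C : Set (κ → F)) r δ t (e i)) :
    HasAvailability (C.map (LinearMap.funLeft F F e) : Set (ι → F)) r δ t i := by
  obtain ⟨R, hR, hinter⟩ := h
  have hmap (j : Fin t) : ((R j).map e.symm.toEmbedding).map e.toEmbedding = R j := by
    ext
    simp
  refine ⟨fun j => (R j).map e.symm.toEmbedding, fun j => ?_, fun j l hjl => ?_⟩
  · refine IsLocalRepairSet.map_funLeft e ?_
    rw [hmap]
    exact hR j
  · rw [← Finset.map_inter, hinter j l hjl]
    simp

theorem IsInformationSet.map_funLeft [Field F] (e : ι ≃ κ) {C : Submodule F (κ → F)}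
    {K : Finset κ} (h : IsInformationSet (C : Set (κ → F)) K) :
    IsInformationSet (C.map (LinearMap.funLeft F F e) : Set (ι → F))
      (K.map e.symm.toEmbedding) := by
  have hmap (K : Finset κ) : (K.map e.symm.toEmbedding).map e.toEmbedding = K := by
    ext
    simp
  constructor
  · rw [ncard_proj_funLeft, ncard_map_funLeft, hmap, h.1]
  · intro i hi
    rw [ncard_proj_funLeft, ncard_map_funLeft, Finset.map_erase, hmap]
    exact h.2 _ (by simpa using hi)

end Transfer

/-! ### Zeros of linearized polynomials -/

section Gabidulin

variable {ι L : Type*} [Field L] {p k : ℕ}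

/-- Evaluation of the linearized polynomials `∑ i < k, a i * X ^ p ^ i` at the points `g x`. -/
def gabidulin (p k : ℕ) (g : ι → L) : (Fin k → L) →ₗ[L] (ι → L) where
  toFun a x := ∑ i, a i * g x ^ p ^ (i : ℕ)
  map_add' a b := by
    funext x
    simp [add_mul, Finset.sum_add_distrib]
  map_smul' c a := by
    funext x
    simp [Finset.mul_sum, mul_assoc]

variable [Fact p.Prime] [CharP L p] [Algebra (ZMod p) L]

/-- The linearized polynomial `∑ i < k, a i * X ^ p ^ i` as a linear map over the prime field. -/
def linearized (p : ℕ) [Fact p.Prime] [CharP L p] [Algebra (ZMod p) L] (a : Fin k → L) :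
    L →ₗ[ZMod p] L :=
  AddMonoidHom.toZModLinearMap p
    { toFun := fun x => ∑ i, a i * x ^ p ^ (i : ℕ)
      map_zero' := by
        simp [(Fact.out : p.Prime).ne_zero]
      map_add' := fun x y => by
        simp [add_pow_char_pow, mul_add, Finset.sum_add_distrib] }

theorem linearized_apply (a : Fin k → L) (x : L) :
    linearized p a x = ∑ i, a i * x ^ p ^ (i : ℕ) := rfl

/-- A linearized polynomial with `k` coefficients that vanishes at `k` independent points is
zero. -/
theorem eq_zero_of_linearized_eq_zero [Finite L] (g : ι → L) (Y : Finset ι)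
    (hY : LinearIndepOn (ZMod p) g (Y : Set ι)) (hk : k ≤ Y.card) (a : Fin k → L)
    (h : ∀ y ∈ Y, linearized p a (g y) = 0) : a = 0 := by
  classical
  have := Fintype.ofFinite L
  have hp : p.Prime := Fact.out
  -- By linearity all `p ^ Y.card` elements of the span are roots, more than the degree of `P`
  -- allows.
  set V := Submodule.span (ZMod p) (g '' (Y : Set ι)) with hV
  have hle : V ≤ LinearMap.ker (linearized p a) := by
    rw [hV, Submodule.span_le]
    rintro _ ⟨y, hy, rfl⟩
    exact h y hy
  have hfin : Module.finrank (ZMod p) V = Y.card := by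
    have := finrank_span_eq_card hY
    rw [hV, Set.image_eq_range, this]
    simp
  have hcard : Nat.card V = p ^ Y.card := by
    rw [Module.natCard_eq_pow_finrank (K := ZMod p), hfin, Nat.card_zmod]
  let P : Polynomial L := ∑ i : Fin k, Polynomial.monomial (p ^ (i : ℕ)) (a i)
  have hPeval (x : L) : P.eval x = linearized p a x := by
    simp [P, linearized_apply, Polynomial.eval_finsetSum]
  have hPcoeff (i : Fin k) : P.coeff (p ^ (i : ℕ)) = a i := by
    simp only [P, Polynomial.finsetSum_coeff, Polynomial.coeff_monomial]
    rw [Finset.sum_eq_single i]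
    · simp
    · intro j _ hj
      rw [if_neg]
      intro h
      exact hj (Fin.ext (Nat.pow_right_injective hp.two_le h))
    · simp
  have hdeg : P.natDegree < p ^ Y.card := by
    refine lt_of_le_of_lt (Polynomial.natDegree_le_iff_coeff_eq_zero (n := p ^ k - 1).2 ?_) ?_
    · intro N hN
      simp only [P, Polynomial.finsetSum_coeff, Polynomial.coeff_monomial]
      refine Finset.sum_eq_zero fun i _ => if_neg fun h => ?_
      have := Nat.pow_lt_pow_right hp.one_lt i.2
      omega
    · have := Nat.pow_le_pow_right hp.pos hk
      have := Nat.pow_pos (n := k) hp.pos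
      omega
  have hP : P = 0 := by
    refine Polynomial.eq_zero_of_natDegree_lt_card_of_eval_eq_zero' P
      (Finset.univ.filter (· ∈ V)) (fun x hx => ?_) ?_
    · rw [hPeval]
      exact hle (by simpa using hx)
    · rwa [← Fintype.card_subtype, ← Nat.card_eq_fintype_card, hcard]
  funext i
  rw [← hPcoeff, hP]
  simp

/-- Fewer than `k` points are common zeros of a nonzero linearized polynomial with `k`
coefficients. -/
theorem exists_linearized_eq_zero (g : ι → L) (Y : Finset ι) (hk : Y.card < k) :
    ∃ a : Fin k → L, a ≠ 0 ∧ ∀ y ∈ Y, linearized p a (g y) = 0 := by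
  have hker : LinearMap.ker (gabidulin p k fun y : Y => g y) ≠ ⊥ :=
    LinearMap.ker_ne_bot_of_finrank_lt (by simpa using hk)
  obtain ⟨a, ha, ha0⟩ := (Submodule.ne_bot_iff _).1 hker
  exact ⟨a, ha0, fun y hy => congrFun ha ⟨y, hy⟩⟩

end Gabidulin

/-! ### Structured coordinates and counting -/

/-- Coordinates arranged around `k` centres, each of which belongs to `t` blocks having `s` further
elements, together with free elements indexed by `E`. -/
abbrev Coord (k t s : ℕ) (E : Type*) := Fin k ⊕ (Fin k × Fin t × Fin s) ⊕ E

section Card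

variable {k t s : ℕ} {E : Type*} [Fintype E] [DecidableEq E]

theorem card_coord (Y : Finset (Coord k t s E)) :
    Y.card = (∑ i : Fin k, if Sum.inl i ∈ Y then 1 else 0) +
      (∑ i : Fin k, ∑ j : Fin t,
        (Finset.univ.filter fun b : Fin s => Sum.inr (Sum.inl (i, j, b)) ∈ Y).card) +
      ∑ x : E, if Sum.inr (Sum.inr x) ∈ Y then 1 else 0 := by
  have h : Y.card = ∑ y : Coord k t s E, if y ∈ Y then 1 else 0 := by
    simp
  simp only [Finset.card_filter]
  rw [h, Fintype.sum_sum_type, Fintype.sum_sum_type, Fintype.sum_prod_type, add_assoc]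
  simp only [Fintype.sum_prod_type]

/-- Numbering the blocks centre by centre, this selects the first `m`, so that they use as few
centres as possible. -/
theorem sum_ite_val_add_mul_lt {m : ℕ} (hm : m ≤ k * t) :
    ∑ i : Fin k, ∑ j : Fin t, (if (j : ℕ) + t * i < m then 1 else 0) = m := by
  rw [← Fintype.sum_prod_type' (f := fun (i : Fin k) (j : Fin t) =>
    if (j : ℕ) + t * i < m then 1 else 0)]
  have := Equiv.sum_comp (finProdFinEquiv (m := k) (n := t))
    fun x => if (x : ℕ) < m then 1 else 0
  simp only [finProdFinEquiv_apply_val] at this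
  rw [this, ← Finset.card_filter, Fin.card_filter_val_lt, min_eq_right hm]

end Card

/-! ### Rank properties of the point configuration -/

section Point

variable {K L : Type*} [Field K] [Field L] [Algebra K L] {k t s u : ℕ} {E : Type*}

/-- The points of a union of parallel connections of Reed–Solomon configurations: the elements of
the block `(i, j)` lie on the moment curve through the centre `i` spanned by `β (inl i)` and the
vectors `β (inr (inl (i, j, l)))`. -/
def point (β : Coord k t u E → L) (α : Fin s → K) : Coord k t s E → L
  | Sum.inl i => β (Sum.inl i)
  | Sum.inr (Sum.inl (i, j, b)) =>
      β (Sum.inl i) + ∑ l : Fin u, α b ^ ((l : ℕ) + 1) • β (Sum.inr (Sum.inl (i, j, l)))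
  | Sum.inr (Sum.inr x) => β (Sum.inr (Sum.inr x))

/-- A polynomial over `L` of degree at most `u` has more than `u` roots coming from `K`. -/
theorem coeff_eq_zero_of_roots (c₀ : L) (c : Fin u → L) (T : Finset K) (hT : u < T.card)
    (h : ∀ x ∈ T, c₀ + ∑ l : Fin u, x ^ ((l : ℕ) + 1) • c l = 0) : c₀ = 0 ∧ ∀ l, c l = 0 := by
  classical
  have hinj := (algebraMap K L).injective
  let P : Polynomial L :=
    Polynomial.C c₀ + ∑ l : Fin u, Polynomial.monomial ((l : ℕ) + 1) (c l)
  have hP : P = 0 := by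
    refine Polynomial.eq_zero_of_natDegree_lt_card_of_eval_eq_zero' P (T.image (algebraMap K L))
      ?_ ?_
    · intro y hy
      obtain ⟨x, hx, rfl⟩ := Finset.mem_image.1 hy
      rw [← h x hx]
      simp [P, Polynomial.eval_finsetSum, Algebra.smul_def, mul_comm]
    · rw [Finset.card_image_of_injective _ hinj]
      refine lt_of_le_of_lt ?_ hT
      refine Polynomial.natDegree_add_le_of_degree_le (by simp)
        (Polynomial.natDegree_sum_le_of_forall_le _ _ fun l _ => ?_)
      exact (Polynomial.natDegree_monomial_le _).trans l.2
  constructor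
  · have : P.coeff 0 = c₀ := by
      simp [P, Polynomial.finsetSum_coeff, Polynomial.coeff_monomial]
    rw [← this, hP, Polynomial.coeff_zero]
  · intro l
    have : P.coeff ((l : ℕ) + 1) = c l := by
      simp [P, Polynomial.finsetSum_coeff, Polynomial.coeff_monomial,
        Fin.val_inj]
    rw [← this, hP, Polynomial.coeff_zero]

variable (β : Coord k t u E → L) {α : Fin s → K}

/-- A linear map vanishing on more than `u` elements of a block vanishes on the whole block,
including its centre. -/
theorem eq_zero_of_block (hα : Function.Injective α) (f : L →ₗ[K] L) (i : Fin k) (j : Fin t)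
    (S : Finset (Fin s)) (hS : u < S.card)
    (h : ∀ b ∈ S, f (point β α (Sum.inr (Sum.inl (i, j, b)))) = 0) :
    f (point β α (Sum.inl i)) = 0 ∧
      ∀ b, f (point β α (Sum.inr (Sum.inl (i, j, b)))) = 0 := by
  classical
  obtain ⟨h0, hl⟩ := coeff_eq_zero_of_roots (K := K) (f (β (Sum.inl i)))
    (fun l => f (β (Sum.inr (Sum.inl (i, j, l))))) (S.image α)
    (by rwa [Finset.card_image_of_injective _ hα]) (fun x hx => by
      obtain ⟨b, hb, rfl⟩ := Finset.mem_image.1 hx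
      simpa [point] using h b hb)
  exact ⟨h0, fun b => by simp [point, h0, hl]⟩

/-- A linear map vanishing on the centre and on at least `u` further elements of a block vanishes
on the whole block. -/
theorem eq_zero_of_center_of_block (hα : Function.Injective α) (hα0 : ∀ b, α b ≠ 0)
    (f : L →ₗ[K] L) (i : Fin k) (j : Fin t) (S : Finset (Fin s)) (hS : u ≤ S.card)
    (hi : f (point β α (Sum.inl i)) = 0)
    (h : ∀ b ∈ S, f (point β α (Sum.inr (Sum.inl (i, j, b)))) = 0) (b : Fin s) :
    f (point β α (Sum.inr (Sum.inl (i, j, b)))) = 0 := by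
  classical
  have h0' : (0 : K) ∉ S.image α := by
    simp [hα0]
  -- The centre is the curve point at node `0`, which supplies one extra root.
  obtain ⟨h0, hl⟩ := coeff_eq_zero_of_roots (K := K) (f (β (Sum.inl i)))
    (fun l => f (β (Sum.inr (Sum.inl (i, j, l))))) (insert 0 (S.image α))
    (by rw [Finset.card_insert_of_notMem h0', Finset.card_image_of_injective _ hα]; omega)
    (fun x hx => by
      obtain rfl | hx := Finset.mem_insert.1 hx
      · simpa [point] using hi
      · obtain ⟨b, hb, rfl⟩ := Finset.mem_image.1 hx
        simpa [point] using h b hb)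
  simp [point, h0, hl]

/-- At most `u` distinct nonzero nodes admit no nontrivial linear relation between their first
`u` positive powers. -/
theorem eq_zero_of_sum_mul_pow_eq_zero (hα : Function.Injective α) (hα0 : ∀ b, α b ≠ 0)
    (S : Finset (Fin s)) (hS : S.card ≤ u) (d : Fin s → K) (hd : ∀ b ∉ S, d b = 0)
    (h : ∀ l : Fin u, ∑ b, d b * α b ^ ((l : ℕ) + 1) = 0) : d = 0 := by
  classical
  funext b₀
  by_cases hb₀ : b₀ ∈ S
  swap
  · exact hd b₀ hb₀
  -- Pairing the relation with `X * P` kills every term except the one at `b₀`.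
  let P : Polynomial K := ∏ b ∈ S.erase b₀, (Polynomial.X - Polynomial.C (α b))
  have hdeg : P.natDegree < u := by
    rw [Polynomial.natDegree_finsetProd_X_sub_C_eq_card, Finset.card_erase_of_mem hb₀]
    have := Finset.card_pos.2 ⟨b₀, hb₀⟩
    omega
  have hsum : ∑ b, d b * (α b * P.eval (α b)) = 0 := by
    calc ∑ b, d b * (α b * P.eval (α b))
        = ∑ b, ∑ l : Fin u, P.coeff l * (d b * α b ^ ((l : ℕ) + 1)) := by
          refine Finset.sum_congr rfl fun b _ => ?_
          rw [Polynomial.eval_eq_sum_range' hdeg, ← Fin.sum_univ_eq_sum_range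
            (fun l => P.coeff l * α b ^ l), Finset.mul_sum, Finset.mul_sum]
          exact Finset.sum_congr rfl fun l _ => by ring
      _ = 0 := by
          rw [Finset.sum_comm]
          simp [← Finset.mul_sum, h]
  rw [Finset.sum_eq_single b₀] at hsum
  · have hP : P.eval (α b₀) ≠ 0 := by
      simp only [P, Polynomial.eval_prod, Finset.prod_ne_zero_iff]
      intro b hb
      simpa [sub_eq_zero] using fun h => (Finset.ne_of_mem_erase hb) (hα h).symm
    simpa [hP, hα0] using hsum
  · intro b _ hb
    by_cases hbS : b ∈ S
    · have : P.eval (α b) = 0 := by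
        simp only [P, Polynomial.eval_prod]
        exact Finset.prod_eq_zero (Finset.mem_erase.2 ⟨hb, hbS⟩) (by simp)
      simp [this]
    · simp [hd b hbS]
  · simp

/-- A set of points meeting each block in at most `u` elements apart from the centre is
linearly independent. -/
theorem linearIndepOn_point [Fintype E] [DecidableEq E] (B : Module.Basis (Coord k t u E) K L)
    (hα : Function.Injective α) (hα0 : ∀ b, α b ≠ 0) (Y : Finset (Coord k t s E))
    (hY : ∀ i j, (Finset.univ.filter fun b : Fin s =>
      (Sum.inr (Sum.inl (i, j, b)) : Coord k t s E) ∈ Y).card ≤ u) :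
    LinearIndepOn K (point B α) (Y : Set (Coord k t s E)) := by
  rw [linearIndepOn_finset_iff]
  intro f hf
  let c : Coord k t s E → K := fun y => if y ∈ Y then f y else 0
  have hc : ∑ y, c y • point B α y = 0 := by
    simpa [c, ite_smul] using hf
  suffices h : ∀ y, c y = 0 by
    intro y hy
    simpa [c, hy] using h y
  rw [Fintype.sum_sum_type, Fintype.sum_sum_type] at hc
  simp only [Fintype.sum_prod_type, point] at hc
  have hcoord (z : Coord k t u E) := congrArg (fun v => B.repr v z) hc
  have hblock (i : Fin k) (j : Fin t) (b : Fin s) : c (Sum.inr (Sum.inl (i, j, b))) = 0 := by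
    refine congrFun (eq_zero_of_sum_mul_pow_eq_zero (u := u) hα hα0 _ (hY i j)
      (fun b => c (Sum.inr (Sum.inl (i, j, b)))) (fun b hb => ?_) fun l => ?_) b
    · simpa [c] using fun h => absurd h (by simpa using hb)
    -- This basis vector occurs only in the points of block `(i, j)`.
    · have := hcoord (Sum.inr (Sum.inl (i, j, l)))
      simpa [Finsupp.single_apply, Finset.sum_ite_eq, Finsupp.finsetSum_apply, Prod.ext_iff, ite_and] using this
  rintro (i | ⟨i, j, b⟩ | x)
  · have := hcoord (Sum.inl i)
    simpa [hblock, Finsupp.single_apply] using this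
  · exact hblock i j b
  · have := hcoord (Sum.inr (Sum.inr x))
    simpa [hblock, Finsupp.single_apply] using this

end Point

/-! ### The code: availability, information set, minimum distance -/

section Code

/-- The centres. -/
def centers (k t s : ℕ) (E : Type*) : Finset (Coord k t s E) :=
  Finset.univ.map Function.Embedding.inl

theorem card_centers (k t s : ℕ) (E : Type*) : (centers k t s E).card = k := by
  simp [centers]

variable {L : Type*} [Field L] {p : ℕ} [Fact p.Prime] [Algebra (ZMod p) L]
  {k t u w : ℕ} {E : Type*}
  (B : Module.Basis (Coord k t u E) (ZMod p) L) {α : Fin (u + w) → ZMod p}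

/-- Linearized polynomials evaluated at the points of the Reed–Solomon configuration. -/
noncomputable def lrcCode (B : Module.Basis (Coord k t u E) (ZMod p) L) (α : Fin (u + w) → ZMod p) :
    Submodule L (Coord k t (u + w) E → L) :=
  LinearMap.range (gabidulin p k (point B α))

theorem mem_lrcCode (a : Fin k → L) : gabidulin p k (point B α) a ∈ lrcCode B α :=
  LinearMap.mem_range_self _ a

variable [DecidableEq E]

theorem linearIndepOn_centers [Fintype E] (hα : Function.Injective α) (hα0 : ∀ b, α b ≠ 0) :
    LinearIndepOn (ZMod p) (point B α) (centers k t (u + w) E : Set (Coord k t (u + w) E)) :=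
  linearIndepOn_point B hα hα0 _ fun i j => by simp [centers]

variable [CharP L p]

/-- The repair sets are the blocks through the centre. Deleting the centre and at most `w - 1` other
elements leaves `u + 1` points, which determine the block. -/
theorem hasAvailability_center (hα : Function.Injective α) (i : Fin k) :
    HasAvailability (lrcCode B α : Set (Coord k t (u + w) E → L)) (u + 1) (w + 1) t (Sum.inl i) := by
  let block (j : Fin t) : Fin (u + w) ↪ Coord k t (u + w) E :=
    ⟨fun b => Sum.inr (Sum.inl (i, j, b)), fun b b' h => by simpa using h⟩
  have hnot (j : Fin t) : Sum.inl i ∉ Finset.univ.map (block j) := by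
    simp [block]
  refine ⟨fun j => insert (Sum.inl i) (Finset.univ.map (block j)), fun j => ?_, fun j l hjl => ?_⟩
  · have hcard : (insert (Sum.inl i) (Finset.univ.map (block j))).card = u + w + 1 := by
      rw [Finset.card_insert_of_notMem (hnot j)]
      simp
    refine ⟨Finset.mem_insert_self _ _, by rw [hcard]; push_cast; omega, fun X hX hX' => ?_⟩
    rw [hcard] at hX'
    refine ncard_proj_eq_of_vanish _ (hX.trans (Finset.erase_subset _ _)) ?_
    rw [Finset.erase_insert (hnot j)] at hX
    obtain ⟨S, rfl⟩ : ∃ S : Finset (Fin (u + w)), X = S.map (block j) := by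
      obtain ⟨S, -, hS⟩ := Finset.subset_map_iff.1 hX
      exact ⟨S, hS⟩
    rintro _ ⟨a, rfl⟩ h
    have hS : u < S.card := by
      rw [Finset.card_map] at hX'
      push_cast at hX'
      omega
    obtain ⟨h0, hb⟩ := eq_zero_of_block B hα (linearized p a) i j S hS fun b hb =>
      h _ (Finset.mem_map_of_mem (block j) hb)
    intro y hy
    obtain rfl | hy := Finset.mem_insert.1 hy
    · exact h0
    · obtain ⟨b, -, rfl⟩ := Finset.mem_map.1 hy
      exact hb b
  · ext y
    simp only [Finset.mem_inter, Finset.mem_insert, Finset.mem_map, Finset.mem_singleton,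
      Finset.mem_univ, true_and]
    constructor
    · rintro ⟨h | ⟨b, rfl⟩, h | ⟨b', h⟩⟩
      · exact h
      · assumption
      · exact h
      · have h' : (Sum.inr (Sum.inl (i, l, b')) : Coord k t (u + w) E) =
            Sum.inr (Sum.inl (i, j, b)) := h
        simp only [Sum.inr.injEq, Sum.inl.injEq, Prod.mk.injEq, true_and] at h'
        exact absurd h'.1.symm hjl
    · rintro rfl
      simp

variable [Fintype E]

theorem eq_zero_of_vanish_centers [Finite L] (hα : Function.Injective α) (hα0 : ∀ b, α b ≠ 0)
    (a : Fin k → L) (h : ∀ y ∈ centers k t (u + w) E, gabidulin p k (point B α) a y = 0) :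
    a = 0 :=
  eq_zero_of_linearized_eq_zero _ _ (linearIndepOn_centers B hα hα0) (card_centers _ _ _ _).ge a h

theorem gabidulin_injective [Finite L] (hα : Function.Injective α) (hα0 : ∀ b, α b ≠ 0) :
    Function.Injective (gabidulin p k (point B α)) := by
  rw [← LinearMap.ker_eq_bot, LinearMap.ker_eq_bot']
  intro a ha
  exact eq_zero_of_vanish_centers B hα hα0 a fun y _ => congrFun ha y

theorem finrank_lrcCode [Finite L] (hα : Function.Injective α) (hα0 : ∀ b, α b ≠ 0) :
    Module.finrank L (lrcCode B α) = k := by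
  rw [lrcCode, LinearMap.finrank_range_of_inj (gabidulin_injective B hα hα0)]
  simp

theorem ncard_proj_lrcCode_lt_iff [Finite L] (hα : Function.Injective α) (hα0 : ∀ b, α b ≠ 0)
    (X : Finset (Coord k t (u + w) E)) :
    (proj (lrcCode B α : Set (Coord k t (u + w) E → L)) X).ncard < (lrcCode B α : Set (Coord k t (u + w) E → L)).ncard ↔
      ∃ a : Fin k → L, a ≠ 0 ∧ ∀ x ∈ X, linearized p a (point B α x) = 0 := by
  rw [ncard_proj_lt_iff]
  constructor
  · rintro ⟨_, ⟨a, rfl⟩, ha, h⟩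
    exact ⟨a, fun h0 => ha (by rw [h0, map_zero]), h⟩
  · rintro ⟨a, ha, h⟩
    refine ⟨_, mem_lrcCode B a, fun h0 => ha (gabidulin_injective B hα hα0 ?_), h⟩
    rw [h0, map_zero]

theorem isInformationSet_centers [Finite L] (hα : Function.Injective α) (hα0 : ∀ b, α b ≠ 0) :
    IsInformationSet (lrcCode B α : Set (Coord k t (u + w) E → L)) (centers k t (u + w) E) := by
  constructor
  · rw [← ncard_proj_univ (lrcCode B α : Set (Coord k t (u + w) E → L))]
    refine ncard_proj_eq_of_vanish _ (Finset.subset_univ _) ?_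
    rintro _ ⟨a, rfl⟩ h y _
    rw [eq_zero_of_vanish_centers B hα hα0 a h, map_zero, Pi.zero_apply]
  · intro i hi
    rw [ncard_proj_lrcCode_lt_iff B hα hα0]
    refine exists_linearized_eq_zero _ _ ?_
    have := Finset.card_erase_lt_of_mem hi
    rwa [card_centers] at this

/-- A bound on the number of zeros of a nonzero codeword. -/
theorem card_le_of_vanish [Finite L] (hα : Function.Injective α) (hα0 : ∀ b, α b ≠ 0)
    (hk : 1 ≤ k) {a : Fin k → L} (ha : a ≠ 0) (X : Finset (Coord k t (u + w) E))
    (h : ∀ x ∈ X, linearized p a (point B α x) = 0) :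
    X.card ≤ k - 1 + t * (k - 1) / (t * u + 1) * w := by
  classical
  let S (i : Fin k) (j : Fin t) : Finset (Fin (u + w)) :=
    Finset.univ.filter fun b => (Sum.inr (Sum.inl (i, j, b)) : Coord k t (u + w) E) ∈ X
  have hSvanish (i : Fin k) (j : Fin t) (b : Fin (u + w)) (hb : b ∈ S i j) :
      linearized p a (point B α (Sum.inr (Sum.inl (i, j, b)))) = 0 :=
    h _ (by simpa [S] using hb)
  have hScard (i : Fin k) (j : Fin t) : (S i j).card ≤ u + w := by
    simpa using Finset.card_le_univ (S i j)
  choose T hTS hT using fun i j =>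
    Finset.exists_subset_card_eq (s := S i j) (min_le_left _ u)
  let full (i : Fin k) (j : Fin t) : ℕ := if u < (S i j).card then 1 else 0
  -- An independent set of zeros: each block is trimmed to at most `u` elements, and a block with
  -- more than `u` zeros contributes its centre, which is then also a zero.
  let Y : Finset (Coord k t (u + w) E) := Finset.univ.filter fun y => match y with
    | Sum.inl i => Sum.inl i ∈ X ∨ ∃ j, u < (S i j).card
    | Sum.inr (Sum.inl (i, j, b)) => b ∈ T i j
    | Sum.inr (Sum.inr x) => Sum.inr (Sum.inr x) ∈ X
  have hYl (i : Fin k) : Sum.inl i ∈ Y ↔ Sum.inl i ∈ X ∨ ∃ j, u < (S i j).card := by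
    simp [Y]
  have hYb (i : Fin k) (j : Fin t) (b : Fin (u + w)) :
      Sum.inr (Sum.inl (i, j, b)) ∈ Y ↔ b ∈ T i j := by
    simp [Y]
  have hYx (x : E) : Sum.inr (Sum.inr x) ∈ Y ↔ Sum.inr (Sum.inr x) ∈ X := by
    simp [Y]
  have hYvanish : ∀ y ∈ Y, linearized p a (point B α y) = 0 := by
    rintro (i | ⟨i, j, b⟩ | x) hy
    · obtain hi | ⟨j, hj⟩ := (hYl i).1 hy
      · exact h _ hi
      · exact (eq_zero_of_block B hα _ i j _ hj (hSvanish i j)).1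
    · exact hSvanish i j b (hTS i j ((hYb i j b).1 hy))
    · exact h _ ((hYx x).1 hy)
  have hYlt : Y.card < k := by
    by_contra! hle
    refine ha (eq_zero_of_linearized_eq_zero _ Y (linearIndepOn_point B hα hα0 Y fun i j => ?_)
      hle a hYvanish)
    simp only [hYb, Finset.filter_mem_eq_inter, Finset.univ_inter, hT]
    exact min_le_right _ _
  have hYcard := card_coord Y
  have hXcard := card_coord X
  simp only [hYb, hYx, Finset.filter_mem_eq_inter, Finset.univ_inter, hT] at hYcard
  have hX : X.card ≤ Y.card + (∑ i, ∑ j, full i j) * w := by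
    have h1 : (∑ i : Fin k, if (Sum.inl i : Coord k t (u + w) E) ∈ X then 1 else 0) ≤
        ∑ i : Fin k, if (Sum.inl i : Coord k t (u + w) E) ∈ Y then 1 else 0 := by
      refine Finset.sum_le_sum fun i _ => ?_
      by_cases hi : (Sum.inl i : Coord k t (u + w) E) ∈ X
      · simp [hi, hYl]
      · simp [hi]
    have h2 : ∑ i, ∑ j, (S i j).card ≤
        ∑ i, ∑ j, min (S i j).card u + (∑ i, ∑ j, full i j) * w := by
      simp only [Finset.sum_mul, ← Finset.sum_add_distrib]
      refine Finset.sum_le_sum fun i _ => Finset.sum_le_sum fun j _ => ?_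
      have := hScard i j
      simp only [full]
      split_ifs <;> omega
    simp only [S] at h2 hYcard
    omega
  have hfull : (∑ i, ∑ j, full i j) * (t * u + 1) ≤ t * (k - 1) := by
    refine le_trans ?_ (Nat.mul_le_mul_left t (Nat.le_sub_one_of_lt hYlt))
    have h1 : ∑ i : Fin k, ((if (Sum.inl i : Coord k t (u + w) E) ∈ Y then 1 else 0) +
        ∑ j, min (S i j).card u) ≤ Y.card := by
      rw [Finset.sum_add_distrib]
      omega
    refine le_trans ?_ (Nat.mul_le_mul_left t h1)
    rw [Finset.mul_sum, Finset.sum_mul]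
    refine Finset.sum_le_sum fun i _ => ?_
    have h2 : (∑ j, full i j) * u ≤ ∑ j, min (S i j).card u := by
      rw [Finset.sum_mul]
      refine Finset.sum_le_sum fun j _ => ?_
      simp only [full]
      split_ifs <;> simp; omega
    -- A centre serves at most `t` full blocks, and only when it lies in `Y`.
    have h3 : ∑ j, full i j ≤ t * if (Sum.inl i : Coord k t (u + w) E) ∈ Y then 1 else 0 := by
      split_ifs with hi
      · calc ∑ j, full i j ≤ ∑ _j : Fin t, 1 :=
              Finset.sum_le_sum fun j _ => by simp only [full]; split_ifs <;> simp
          _ = t * 1 := by simp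
      · rw [hYl] at hi
        push Not at hi
        simp [full, (hi.2 _).not_gt]
    nlinarith [Nat.mul_le_mul_left t h2]
  have hm := (Nat.le_div_iff_mul_le (by positivity)).2 hfull
  have := Nat.mul_le_mul_right w hm
  omega

/-- The bound on the number of zeros of a nonzero codeword is attained. -/
theorem exists_card_eq_of_vanish (hα : Function.Injective α) (hα0 : ∀ b, α b ≠ 0)
    (hk : 1 ≤ k) : ∃ (a : Fin k → L) (X : Finset (Coord k t (u + w) E)), a ≠ 0 ∧
      (∀ x ∈ X, linearized p a (point B α x) = 0) ∧
      X.card = k - 1 + t * (k - 1) / (t * u + 1) * w := by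
  classical
  set m := t * (k - 1) / (t * u + 1) with hm
  have hmle : m * (t * u + 1) ≤ t * (k - 1) := Nat.div_mul_le_self _ _
  have hmkt : m ≤ k * t := by
    calc m ≤ t * (k - 1) := Nat.div_le_self _ _
      _ ≤ t * k := Nat.mul_le_mul_left t (Nat.sub_le k 1)
      _ = k * t := mul_comm _ _
  have hmu : m * u ≤ k - 1 := by
    obtain rfl | ht := Nat.eq_zero_or_pos t
    · simp [hm]
    · refine Nat.le_of_mul_le_mul_left ?_ ht
      nlinarith
  -- `Z u` has `k - 1` elements, so some nonzero polynomial vanishes on it; the block property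
  -- extends the vanishing to `Z (u + w)`.
  let Z (v : ℕ) : Finset (Coord k t (u + w) E) := Finset.univ.filter fun y => match y with
    | Sum.inl i => (i : ℕ) < k - 1 - m * u
    | Sum.inr (Sum.inl (i, j, b)) => (j : ℕ) + t * i < m ∧ (b : ℕ) < v
    | Sum.inr (Sum.inr _) => False
  have hZl (v : ℕ) (i : Fin k) : Sum.inl i ∈ Z v ↔ (i : ℕ) < k - 1 - m * u := by
    simp [Z]
  have hZb (v : ℕ) (i : Fin k) (j : Fin t) (b : Fin (u + w)) :
      Sum.inr (Sum.inl (i, j, b)) ∈ Z v ↔ (j : ℕ) + t * i < m ∧ (b : ℕ) < v := by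
    simp [Z]
  have hZx (v : ℕ) (x : E) : Sum.inr (Sum.inr x) ∉ Z v := by
    simp [Z]
  have hZcard (v : ℕ) (hv : v ≤ u + w) : (Z v).card = k - 1 - m * u + m * v := by
    rw [card_coord]
    have h1 (i : Fin k) (j : Fin t) :
        (Finset.univ.filter fun b : Fin (u + w) =>
          (Sum.inr (Sum.inl (i, j, b)) : Coord k t (u + w) E) ∈ Z v).card =
        (if (j : ℕ) + t * i < m then 1 else 0) * v := by
      simp only [hZb]
      split_ifs with hij
      · simp [hij, Fin.card_filter_val_lt, hv]
      · simp [hij]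
    simp only [h1, hZl, hZx, ← Finset.sum_mul, sum_ite_val_add_mul_lt hmkt]
    rw [← Finset.card_filter, Fin.card_filter_val_lt, min_eq_right (by omega)]
    simp
  obtain ⟨a, ha, hvanish⟩ := exists_linearized_eq_zero (p := p) (k := k) (point B α) (Z u) (by
    rw [hZcard u (Nat.le_add_right u w)]
    omega)
  refine ⟨a, Z (u + w), ha, ?_, ?_⟩
  · rintro (i | ⟨i, j, b⟩ | x) hx
    · exact hvanish _ ((hZl u i).2 ((hZl _ i).1 hx))
    · have hij := ((hZb _ i j b).1 hx).1
      refine eq_zero_of_center_of_block B hα hα0 _ i j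
        (Finset.univ.filter fun b : Fin (u + w) => (b : ℕ) < u) ?_ ?_ ?_ b
      · simp [Fin.card_filter_val_lt]
      · refine hvanish _ ((hZl u i).2 ?_)
        have ht : 0 < t := j.pos
        -- The centre of a chosen block is in `Z u`: `t * i < m ≤ t * (k - 1 - m * u)`.
        refine Nat.lt_of_mul_lt_mul_left (a := t) ?_
        have : t * i < m := by omega
        rw [Nat.mul_sub]
        have : t * (m * u) + m ≤ t * (k - 1) := by linarith
        omega
      · intro b' hb'
        exact hvanish _ ((hZb u i j b').2 ⟨hij, by simpa using hb'⟩)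
    · exact absurd hx (hZx _ x)
  · rw [hZcard _ le_rfl, Nat.mul_add]
    omega

theorem isMinDist_lrcCode [Finite L] (hα : Function.Injective α) (hα0 : ∀ b, α b ≠ 0)
    (hk : 1 ≤ k) :
    IsMinDist (lrcCode B α : Set (Coord k t (u + w) E → L))
      (Fintype.card (Coord k t (u + w) E) - (k - 1 + t * (k - 1) / (t * u + 1) * w)) := by
  constructor
  · obtain ⟨a, X, ha, hX, hcard⟩ := exists_card_eq_of_vanish (w := w) B hα hα0 hk
    refine ⟨Xᶜ, by rw [Finset.card_compl, hcard], ?_⟩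
    rw [compl_compl, ncard_proj_lrcCode_lt_iff B hα hα0]
    exact ⟨a, ha, hX⟩
  · rintro _ ⟨X, rfl, hlt⟩
    obtain ⟨a, ha, hX⟩ := (ncard_proj_lrcCode_lt_iff B hα hα0 _).1 hlt
    have := card_le_of_vanish B hα hα0 hk ha _ hX
    rw [Finset.card_compl] at this
    omega

end Code

/-! ### Arithmetic of the Singleton-type bound -/

theorem ceil_div_add_one (a b : ℕ) :
    ⌈((a : ℚ) + 1) / ((b : ℚ) + 1)⌉ = ((a / (b + 1) : ℕ) : ℤ) + 1 := by
  have hb : (0 : ℚ) < b + 1 := by positivity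
  rw [Int.ceil_eq_iff, lt_div_iff₀ hb, div_le_iff₀ hb]
  have h1 := Nat.div_mul_le_self a (b + 1)
  have h2 : a + 1 ≤ a / (b + 1) * (b + 1) + (b + 1) :=
    Nat.lt_div_mul_add (a := a) (b := b + 1) (by omega)
  generalize a / (b + 1) = q at h1 h2 ⊢
  have h1' : (q : ℚ) * (b + 1) ≤ a := by exact_mod_cast h1
  have h2' : (a : ℚ) + 1 ≤ q * (b + 1) + (b + 1) := by exact_mod_cast h2
  constructor <;> push_cast <;> linarith

theorem singletonBound_eq {n k t u w : ℕ} (hk : 1 ≤ k)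
    (hle : k - 1 + t * (k - 1) / (t * u + 1) * w ≤ n) :
    ((n - (k - 1 + t * (k - 1) / (t * u + 1) * w) : ℕ) : ℤ) =
      singletonBound n k (u + 1) (w + 1) t := by
  have hceil := ceil_div_add_one (t * (k - 1)) (t * u)
  rw [Nat.cast_sub hle, singletonBound]
  obtain ⟨k, rfl⟩ : ∃ l, k = l + 1 := ⟨k - 1, by omega⟩
  simp only [Nat.add_sub_cancel] at hceil ⊢
  push_cast at hceil ⊢
  simp only [add_sub_cancel_right]
  rw [hceil]
  ring

end LRC

/-! ### Choice of field and assembly -/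

theorem theorem4p5 (n k r δ t : ℕ) (hk : 1 ≤ k) (hr : 1 ≤ r) (hδ : 2 ≤ δ)
    (hn : k * (t * (r + δ - 2) + 1) ≤ n) :
    ∃ (F : Type) (_ : Field F) (_ : Finite F) (C : Submodule F (Fin n → F)) (d : ℕ),
      LRC.IsLinearLRC C k d r δ t ∧ (d : ℤ) = LRC.singletonBound n k r δ t := by
  obtain ⟨u, rfl⟩ : ∃ u, r = u + 1 := ⟨r - 1, by omega⟩
  obtain ⟨w, rfl⟩ : ∃ w, δ = w + 1 := ⟨δ - 1, by omega⟩
  rw [show u + 1 + (w + 1) - 2 = u + w by omega] at hn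
  obtain ⟨e, rfl⟩ := Nat.exists_eq_add_of_le hn
  -- The prime exceeds `u + w`, so the nodes `1, …, u + w` are distinct and nonzero; node `0` is
  -- kept for the centres.
  obtain ⟨p, hpw, hp⟩ := Nat.exists_infinite_primes (u + w + 1)
  have := Fact.mk hp
  let J := LRC.Coord k t u (Fin e)
  -- The degree makes the vectors spanning the configuration a basis of `L`.
  let L := GaloisField p (Fintype.card J)
  have hJ : Fintype.card J ≠ 0 := by
    simp only [J, Fintype.card_sum, Fintype.card_fin]
    omega
  let B : Module.Basis J (ZMod p) L :=
    (Module.finBasisOfFinrankEq (ZMod p) L (GaloisField.finrank p hJ)).reindex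
      (Fintype.equivFin J).symm
  let α (b : Fin (u + w)) : ZMod p := ((b + 1 : ℕ) : ZMod p)
  have hα : Function.Injective α := by
    intro b b' h
    have := (ZMod.natCast_eq_natCast_iff' _ _ _).1 h
    rw [Nat.mod_eq_of_lt (by omega), Nat.mod_eq_of_lt (by omega)] at this
    omega
  have hα0 (b : Fin (u + w)) : α b ≠ 0 := by
    intro h
    have := Nat.le_of_dvd (by omega) ((ZMod.natCast_eq_zero_iff _ _).1 h)
    omega
  have hcard : Fintype.card (LRC.Coord k t (u + w) (Fin e)) = k * (t * (u + w) + 1) + e := by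
    simp only [Fintype.card_sum, Fintype.card_prod, Fintype.card_fin]
    ring
  let φ : Fin (k * (t * (u + w) + 1) + e) ≃ LRC.Coord k t (u + w) (Fin e) :=
    (Fintype.equivFinOfCardEq hcard).symm
  have hmin := LRC.isMinDist_lrcCode B hα hα0 hk
  -- Only the size of `X` matters: it shows that the truncated subtraction in the distance is exact.
  obtain ⟨a, X, -, -, hX⟩ := LRC.exists_card_eq_of_vanish (w := w) B hα hα0 hk
  have hle := Finset.card_le_univ X
  rw [hcard] at hmin hle
  rw [hX] at hle
  refine ⟨L, inferInstance, inferInstance,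
    (LRC.lrcCode B α).map (LinearMap.funLeft L L φ), _,
    ⟨?_, hmin.map_funLeft φ, _, (LRC.isInformationSet_centers B hα hα0).map_funLeft φ, ?_⟩,
    LRC.singletonBound_eq hk hle⟩
  · rw [← LinearEquiv.finrank_eq (Submodule.equivMapOfInjective _
      (LinearMap.funLeft_injective_of_surjective L L φ φ.surjective) _)]
    exact LRC.finrank_lrcCode B hα hα0
  · intro x hx
    obtain ⟨y, hy, rfl⟩ := Finset.mem_map.1 hx
    obtain ⟨i, -, rfl⟩ := Finset.mem_map.1 hy
    refine LRC.HasAvailability.map_funLeft φ ?_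
    simpa using LRC.hasAvailability_center B hα i
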